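/- All graphs are finite and simple. A clique of a graph $G$ is a maximal set of pairwise adjacent vertices. The clique graph $K(G)$ has the cliques of $G$ as its vertices, two distinct cliques being adjacent if and only if they have a common vertex. Put $K^0(G)=G$ and $K^{m}(G)=K(K^{m-1}(G))$ for $m\ge 1$. The graph $G$ is called clique-divergent if the sequence $K^0(G),K^1(G),K^2(G),\dots$ contains infinitely many pairwise non-isomorphic graphs. Theorem. Let $G$ be a $2$-regular graph with $n$ vertices, not necessarily connected. If $n\ge 9$, then the complement $\overline{G}$ is clique-divergent. -/

import Mathlib

universe u

namespace SimpleGraph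

/-- The clique graph `K(G)`: its vertices are the cliques of `G` (the maximal sets of pairwise
adjacent vertices), and two distinct cliques are adjacent when they share a vertex. -/
def cliqueGraph {V : Type u} (G : SimpleGraph V) :
    SimpleGraph {s : Set V // Maximal G.IsClique s} where
  Adj s t := s ≠ t ∧ ((s : Set V) ∩ (t : Set V)).Nonempty
  symm := ⟨fun _ _ h => ⟨h.1.symm, Set.inter_comm _ _ ▸ h.2⟩⟩
  loopless := ⟨fun _ h => h.1 rfl⟩

/-- The iterated clique graph `Kⁿ(G)`, together with its vertex type:
`K⁰(G) = G` and `Kⁿ⁺¹(G) = K(Kⁿ(G))`. -/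
def iterCliqueGraph {V : Type u} (G : SimpleGraph V) : ℕ → (Σ W : Type u, SimpleGraph W)
  | 0 => ⟨V, G⟩
  | n + 1 => ⟨_, (iterCliqueGraph G n).2.cliqueGraph⟩

/-- Isomorphism of graphs, as an equivalence relation on all graphs in a universe. -/
def isoSetoid : Setoid (Σ W : Type u, SimpleGraph W) where
  r A B := Nonempty (A.2 ≃g B.2)
  iseqv := ⟨fun _ => ⟨Iso.refl⟩, fun ⟨e⟩ => ⟨e.symm⟩, fun ⟨e⟩ ⟨f⟩ => ⟨e.trans f⟩⟩

/-- `G` is convergent under the clique graph operator: only finitely many isomorphism classes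
occur among the iterated clique graphs of `G`. -/
def CliqueConvergent {V : Type u} (G : SimpleGraph V) : Prop :=
  (Set.range fun n : ℕ => Quotient.mk isoSetoid (iterCliqueGraph G n)).Finite

/-- `G` is divergent under the clique graph operator. -/
def CliqueDivergent {V : Type u} (G : SimpleGraph V) : Prop :=
  ¬ G.CliqueConvergent

end SimpleGraph

/-! Orient the cycles of `G` to get a permutation `σ`. It is an automorphism of `Gᶜ` carrying each
vertex to a different non-neighbour (a coaffination), and this property passes to every iterated
clique graph. Call orbits of `σ` joined if any two vertices from different ones are adjacent.
Representatives of joined orbits are distinct, so `r` joined orbits force at least `r` vertices.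

The engine is `IsCoaffination.hasJoinedOrbits_succ`: for `r ≥ 3`, applying `K` twice turns `r`
joined orbits into `r + 1`. Three joined orbits anywhere in the sequence therefore make the orders
unbounded.

It remains to produce three joined orbits. Three cycles of `G` give them at once. One long cycle, or
two cycles one of which has length at least 6, is handled by
`IsCoaffination.cliqueDivergent_of_dominating`, a local configuration giving three joined orbits in
`K²`. Since `n ≥ 9`, only the cycle lengths 4+5 and 5+5 are left. The first reduces to the argument
for a single even cycle, one clique graph later; in the second the three orbits are written down in
`K²`. -/

namespace SimpleGraph

variable {V : Type u}

/-! ### Coaffinations and their action on cliques -/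

/-- Reflexive adjacency. -/
def AdjOrEq (G : SimpleGraph V) (x y : V) : Prop := x = y ∨ G.Adj x y

theorem AdjOrEq.refl {G : SimpleGraph V} (x : V) : G.AdjOrEq x x := Or.inl rfl

theorem AdjOrEq.symm {G : SimpleGraph V} {x y : V} (h : G.AdjOrEq x y) : G.AdjOrEq y x :=
  h.elim (fun h => Or.inl h.symm) fun h => Or.inr h.symm

theorem isClique_iff_adjOrEq {G : SimpleGraph V} {s : Set V} :
    G.IsClique s ↔ ∀ x ∈ s, ∀ y ∈ s, G.AdjOrEq x y := by
  constructor
  · intro h x hx y hy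
    by_cases e : x = y
    · exact Or.inl e
    · exact Or.inr (h hx hy e)
  · intro h x hx y hy e
    exact (h x hx y hy).resolve_left e

/-- An automorphism that maps every vertex to a different, nonadjacent vertex. -/
structure IsCoaffination (G : SimpleGraph V) (σ : Equiv.Perm V) : Prop where
  adj_iff : ∀ x y, G.Adj (σ x) (σ y) ↔ G.Adj x y
  not_adjOrEq : ∀ x, ¬ G.AdjOrEq x (σ x)

theorem exists_maximal_isClique [Finite V] {G : SimpleGraph V} {s : Set V}
    (hs : G.IsClique s) : ∃ Q : {s : Set V // Maximal G.IsClique s}, s ⊆ Q := by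
  obtain ⟨Q, h, hQ⟩ := (Set.toFinite {s : Set V | G.IsClique s}).exists_le_maximal hs
  exact ⟨⟨Q, hQ⟩, h⟩

theorem nonempty_of_maximal_isClique [Nonempty V] {G : SimpleGraph V} {s : Set V}
    (hs : Maximal G.IsClique s) : s.Nonempty := by
  by_contra h
  rw [Set.not_nonempty_iff_eq_empty] at h
  subst h
  obtain ⟨x⟩ := ‹Nonempty V›
  exact hs.2 (y := {x}) (by simp) (by simp) rfl

theorem cliqueGraph_adjOrEq {G : SimpleGraph V} {s t : {s : Set V // Maximal G.IsClique s}}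
    {x : V} (hs : x ∈ (s : Set V)) (ht : x ∈ (t : Set V)) : G.cliqueGraph.AdjOrEq s t := by
  by_cases e : s = t
  · exact Or.inl e
  · exact Or.inr ⟨e, x, hs, ht⟩

theorem exists_mem_of_cliqueGraph_adjOrEq [Nonempty V] {G : SimpleGraph V}
    {s t : {s : Set V // Maximal G.IsClique s}} (h : G.cliqueGraph.AdjOrEq s t) :
    ∃ x ∈ (s : Set V), x ∈ (t : Set V) := by
  rcases h with rfl | h
  · obtain ⟨x, hx⟩ := nonempty_of_maximal_isClique s.2
    exact ⟨x, hx, hx⟩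
  · exact h.2

namespace IsCoaffination

variable {G : SimpleGraph V} {σ : Equiv.Perm V}

theorem isClique_image (h : G.IsCoaffination σ) {s : Set V} :
    G.IsClique (σ '' s) ↔ G.IsClique s := by
  constructor
  · intro hs x hx y hy e
    exact (h.adj_iff x y).1 (hs ⟨x, hx, rfl⟩ ⟨y, hy, rfl⟩ (σ.injective.ne e))
  · rintro hs _ ⟨x, hx, rfl⟩ _ ⟨y, hy, rfl⟩ e
    exact (h.adj_iff x y).2 (hs hx hy fun e' => e (e' ▸ rfl))

theorem maximal_image (h : G.IsCoaffination σ) {s : Set V} :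
    Maximal G.IsClique (σ '' s) ↔ Maximal G.IsClique s := by
  constructor
  · rintro ⟨h1, h2⟩
    refine ⟨h.isClique_image.1 h1, fun t ht hst => ?_⟩
    exact (Set.image_subset_image_iff σ.injective).1
      (h2 (h.isClique_image.2 ht) (Set.image_mono hst))
  · rintro ⟨h1, h2⟩
    refine ⟨h.isClique_image.2 h1, fun t ht hst => ?_⟩
    obtain ⟨t, rfl⟩ : ∃ t', t = σ '' t' := ⟨σ ⁻¹' t, (σ.image_preimage t).symm⟩
    exact Set.image_mono
      (h2 (h.isClique_image.1 ht) ((Set.image_subset_image_iff σ.injective).1 hst))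

/-- The permutation of the cliques induced by a coaffination. -/
def cliquePerm (h : G.IsCoaffination σ) : Equiv.Perm {s : Set V // Maximal G.IsClique s} :=
  (Equiv.Set.congr σ).subtypeEquiv fun s => (h.maximal_image (s := s)).symm

theorem coe_cliquePerm (h : G.IsCoaffination σ) (s : {s : Set V // Maximal G.IsClique s}) :
    (h.cliquePerm s : Set V) = σ '' s := rfl

theorem mem_cliquePerm_iff (h : G.IsCoaffination σ) {s : {s : Set V // Maximal G.IsClique s}}
    {x : V} : x ∈ (h.cliquePerm s : Set V) ↔ σ⁻¹ x ∈ (s : Set V) := by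
  rw [coe_cliquePerm]
  constructor
  · rintro ⟨y, hy, rfl⟩
    simpa using hy
  · intro hx
    exact ⟨_, hx, by simp⟩

theorem mem_cliquePerm_zpow_iff (h : G.IsCoaffination σ)
    {s : {s : Set V // Maximal G.IsClique s}} (p : ℤ) {x : V} :
    x ∈ ((h.cliquePerm ^ p) s : Set V) ↔ (σ ^ (-p)) x ∈ (s : Set V) := by
  induction p generalizing x with
  | zero => simp
  | succ p ih =>
    rw [add_comm, zpow_add, Equiv.Perm.mul_apply, zpow_one, mem_cliquePerm_iff, ih,
      neg_add_rev, zpow_add, Equiv.Perm.mul_apply, zpow_neg_one]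
  | pred p ih =>
    have key : (h.cliquePerm ^ (-(p : ℤ))) s = h.cliquePerm ((h.cliquePerm ^ (-(p : ℤ) - 1)) s) := by
      rw [← Equiv.Perm.mul_apply, ← zpow_one_add]
      congr 2
      ring
    have := ih (x := σ x)
    rw [key, mem_cliquePerm_iff, Equiv.Perm.inv_def, Equiv.symm_apply_apply] at this
    rw [this, ← Equiv.Perm.mul_apply, ← zpow_add_one]
    ring_nf

theorem mem_cliquePerm_zpow_neg_iff (h : G.IsCoaffination σ)
    {s : {s : Set V // Maximal G.IsClique s}} (p : ℤ) {x : V} :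
    x ∈ ((h.cliquePerm ^ (-p)) s : Set V) ↔ (σ ^ p) x ∈ (s : Set V) := by
  rw [mem_cliquePerm_zpow_iff, neg_neg]

theorem zpow_mem_cliquePerm_zpow (h : G.IsCoaffination σ)
    {s : {s : Set V // Maximal G.IsClique s}} (p : ℤ) {x : V} (hx : x ∈ (s : Set V)) :
    (σ ^ p) x ∈ ((h.cliquePerm ^ p) s : Set V) := by
  rw [mem_cliquePerm_zpow_iff, ← Equiv.Perm.mul_apply, ← zpow_add]
  simpa using hx

/-- If a clique met its image, it would contain some `y` together with `σ y`, which are neither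
equal nor adjacent. Nonemptiness excludes the empty clique, which equals its image. -/
theorem cliqueGraph [Nonempty V] (h : G.IsCoaffination σ) :
    G.cliqueGraph.IsCoaffination h.cliquePerm where
  adj_iff s t := by
    simp only [SimpleGraph.cliqueGraph, coe_cliquePerm, ← Set.image_inter σ.injective,
      Set.image_nonempty, ne_eq, EmbeddingLike.apply_eq_iff_eq]
  not_adjOrEq s hs := by
    obtain ⟨x, hx, y, hy, rfl⟩ := exists_mem_of_cliqueGraph_adjOrEq hs
    exact h.not_adjOrEq y (isClique_iff_adjOrEq.1 s.2.1 y hy _ hx)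

theorem adjOrEq_iff (h : G.IsCoaffination σ) (x y : V) :
    G.AdjOrEq (σ x) (σ y) ↔ G.AdjOrEq x y := by
  simp [AdjOrEq, h.adj_iff]

theorem adjOrEq_zpow_iff (h : G.IsCoaffination σ) (p : ℤ) (x y : V) :
    G.AdjOrEq ((σ ^ p) x) ((σ ^ p) y) ↔ G.AdjOrEq x y := by
  induction p with
  | zero => simp
  | succ p ih => rw [add_comm, zpow_one_add]; simpa [h.adjOrEq_iff] using ih
  | pred p ih =>
    rw [← h.adjOrEq_iff, ← Equiv.Perm.mul_apply, ← Equiv.Perm.mul_apply, ← zpow_one_add]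
    simpa using ih

end IsCoaffination

/-! ### Joined orbits and criteria for divergence -/

/-- There are `r` vertices whose orbits under the permutation `σ` are completely joined to each
other. -/
def HasJoinedOrbits (G : SimpleGraph V) (σ : Equiv.Perm V) (r : ℕ) : Prop :=
  ∃ x : Fin r → V, ∀ i j, i ≠ j → ∀ p q : ℤ, G.AdjOrEq ((σ ^ p) (x i)) ((σ ^ q) (x j))

theorem HasJoinedOrbits.le_card [Finite V] {G : SimpleGraph V} {σ : Equiv.Perm V} {r : ℕ}
    (h : G.IsCoaffination σ) (hr : G.HasJoinedOrbits σ r) : r ≤ Nat.card V := by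
  obtain ⟨x, hx⟩ := hr
  have hi : Function.Injective x := by
    intro i j e
    by_contra hij
    have := hx i j hij 0 1
    rw [e] at this
    exact h.not_adjOrEq _ this
  simpa using Nat.card_le_card_of_injective x hi

/-- Families of pairwise adjacent sets whose translates all meet extend to cliques with joined
orbits. -/
theorem IsCoaffination.hasJoinedOrbits_cliqueGraph [Finite V] {G : SimpleGraph V}
    {σ : Equiv.Perm V} (h : G.IsCoaffination σ) {r : ℕ} (S : Fin r → Set V)
    (hS : ∀ i, G.IsClique (S i))
    (hm : ∀ i j, i < j → ∀ p q : ℤ, ∃ x, (σ ^ (-p)) x ∈ S i ∧ (σ ^ (-q)) x ∈ S j) :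
    G.cliqueGraph.HasJoinedOrbits h.cliquePerm r := by
  choose Q hQ using fun i => exists_maximal_isClique (hS i)
  have key : ∀ i j, i < j → ∀ p q : ℤ,
      G.cliqueGraph.AdjOrEq ((h.cliquePerm ^ p) (Q i)) ((h.cliquePerm ^ q) (Q j)) := by
    intro i j hij p q
    obtain ⟨x, hx, hy⟩ := hm i j hij p q
    exact cliqueGraph_adjOrEq ((h.mem_cliquePerm_zpow_iff p).2 (hQ i hx))
      ((h.mem_cliquePerm_zpow_iff q).2 (hQ j hy))
  refine ⟨Q, fun i j hij p q => ?_⟩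
  rcases lt_or_gt_of_ne hij with hij | hij
  · exact key i j hij p q
  · exact (key j i hij q p).symm

/-- A clique containing prescribed pairwise adjacent vertices, as a triple. -/
theorem exists_clique_triple [Finite V] {G : SimpleGraph V} {x y z : V} (hxy : G.AdjOrEq x y)
    (hxz : G.AdjOrEq x z) (hyz : G.AdjOrEq y z) :
    ∃ Q : {s : Set V // Maximal G.IsClique s}, x ∈ (Q : Set V) ∧ y ∈ (Q : Set V) ∧
      z ∈ (Q : Set V) := by
  have : G.IsClique ({x, y, z} : Set V) := by
    rw [isClique_iff_adjOrEq]
    simp only [Set.mem_insert_iff, Set.mem_singleton_iff]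
    rintro a (rfl | rfl | rfl) b (rfl | rfl | rfl) <;>
      first | exact AdjOrEq.refl _ | assumption | (apply AdjOrEq.symm; assumption)
  obtain ⟨Q, hQ⟩ := exists_maximal_isClique this
  exact ⟨Q, hQ (by simp), hQ (by simp), hQ (by simp)⟩

/-- The stars of the `x i` supply `r` orbits in `K²`. The new one comes from the cliques containing
at least two of three fixed `x i`: any two such cliques meet by pigeonhole. -/
theorem IsCoaffination.hasJoinedOrbits_succ [Finite V] [Nonempty V] {G : SimpleGraph V}
    {σ : Equiv.Perm V} (h : G.IsCoaffination σ) {r : ℕ} (hr : 3 ≤ r)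
    (hj : G.HasJoinedOrbits σ r) :
    G.cliqueGraph.cliqueGraph.HasJoinedOrbits h.cliqueGraph.cliquePerm (r + 1) := by
  obtain ⟨x, hx⟩ := hj
  let a : Fin r := ⟨0, by omega⟩
  let b : Fin r := ⟨1, by omega⟩
  let c : Fin r := ⟨2, by omega⟩
  have hab : a ≠ b := by simp [a, b]
  have hac : a ≠ c := by simp [a, c]
  have hbc : b ≠ c := by simp [b, c]
  let T : Set {s : Set V // Maximal G.IsClique s} :=
    {Q | ∃ i j, i ≠ j ∧ (i = a ∨ i = b ∨ i = c) ∧ (j = a ∨ j = b ∨ j = c) ∧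
      x i ∈ (Q : Set V) ∧ x j ∈ (Q : Set V)}
  refine h.cliqueGraph.hasJoinedOrbits_cliqueGraph
    (Fin.cons T fun i => {Q | x i ∈ (Q : Set V)}) (fun i => ?_) fun i j hij p q => ?_
  · rw [isClique_iff_adjOrEq]
    induction i using Fin.cases with
    | zero =>
      rintro Q ⟨i, j, hij, hi, hj, hiQ, hjQ⟩ R ⟨i', j', hij', hi', hj', hiR, hjR⟩
      have : i = i' ∨ i = j' ∨ j = i' ∨ j = j' := by grind
      rcases this with rfl | rfl | rfl | rfl
      exacts [cliqueGraph_adjOrEq hiQ hiR, cliqueGraph_adjOrEq hiQ hjR,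
        cliqueGraph_adjOrEq hjQ hiR, cliqueGraph_adjOrEq hjQ hjR]
    | succ i => exact fun Q hQ R hR => cliqueGraph_adjOrEq hQ hR
  · induction j using Fin.cases with
    | zero => simp at hij
    | succ j =>
    induction i using Fin.cases with
    | zero =>
      -- Two of the three indices differ from `j`. Their `p`-translates and the `q`-translate of `x
      -- j` lie in a common clique, which belongs to both translated families.
      obtain ⟨k, l, hkl, hk, hl, hkj, hlj⟩ : ∃ k l, k ≠ l ∧ (k = a ∨ k = b ∨ k = c) ∧
          (l = a ∨ l = b ∨ l = c) ∧ k ≠ j ∧ l ≠ j := by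
        by_cases h1 : j = a
        · exact ⟨b, c, by grind⟩
        by_cases h2 : j = b
        · exact ⟨a, c, by grind⟩
        · exact ⟨a, b, by grind⟩
      obtain ⟨Q, h1, h2, h3⟩ := exists_clique_triple (hx k l hkl p p) (hx k j hkj p q)
        (hx l j hlj p q)
      refine ⟨Q, ⟨k, l, hkl, hk, hl, ?_, ?_⟩, ?_⟩ <;>
        exact (h.mem_cliquePerm_zpow_neg_iff _).2 (by assumption)
    | succ i =>
      have hij : i ≠ j := fun e => by simp [e] at hij
      obtain ⟨Q, h1, h2, -⟩ := exists_clique_triple (hx i j hij p q) (hx i j hij p q)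
        (AdjOrEq.refl _)
      refine ⟨Q, ?_, ?_⟩ <;> exact (h.mem_cliquePerm_zpow_neg_iff _).2 (by assumption)

/-- The invariant that is carried along the iterated clique graphs. -/
def HasRank (A : Σ W : Type u, SimpleGraph W) (r : ℕ) : Prop :=
  Finite A.1 ∧ Nonempty A.1 ∧ ∃ σ, A.2.IsCoaffination σ ∧ A.2.HasJoinedOrbits σ r

instance [Finite V] [Nonempty V] (G : SimpleGraph V) :
    Nonempty {s : Set V // Maximal G.IsClique s} :=
  let ⟨Q, _⟩ := exists_maximal_isClique (G := G) (s := ∅) (by simp)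
  ⟨Q⟩

theorem HasRank.iterCliqueGraph {G : SimpleGraph V} {j : ℕ}
    (h : HasRank (iterCliqueGraph G j) 3) (m : ℕ) :
    HasRank (SimpleGraph.iterCliqueGraph G (j + 2 * m)) (3 + m) := by
  induction m with
  | zero => exact h
  | succ m ih =>
    obtain ⟨_, _, σ, h, hr⟩ := ih
    refine ⟨?_, ?_, _, h.cliqueGraph.cliqueGraph, h.hasJoinedOrbits_succ (Nat.le_add_right 3 m) hr⟩
    · exact inferInstanceAs (Finite {s : Set _ // Maximal (SimpleGraph.cliqueGraph _).IsClique s})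
    · exact inferInstanceAs
        (Nonempty {s : Set _ // Maximal (SimpleGraph.cliqueGraph _).IsClique s})

/-- The order is an isomorphism invariant, so convergence would bound it by some `b`; after `2 * b`
further steps it is at least `3 + b`. -/
theorem HasRank.cliqueDivergent {G : SimpleGraph V} {j : ℕ}
    (h : HasRank (SimpleGraph.iterCliqueGraph G j) 3) : G.CliqueDivergent := by
  intro hfin
  let card : Quotient isoSetoid.{u} → ℕ :=
    Quotient.lift (fun A => Nat.card A.1) fun A B ⟨e⟩ => Nat.card_congr e.toEquiv
  obtain ⟨b, hb⟩ := (hfin.image card).bddAbove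
  obtain ⟨_, _, σ, hσ, hr⟩ := h.iterCliqueGraph b
  have h1 := hr.le_card hσ
  have h2 := hb ⟨_, ⟨j + 2 * b, rfl⟩, rfl⟩
  have : Nat.card (SimpleGraph.iterCliqueGraph G (j + 2 * b)).1 ≤ b := h2
  omega

theorem IsCoaffination.cliqueDivergent [Finite V] [Nonempty V] {G : SimpleGraph V}
    {σ : Equiv.Perm V} (h : G.IsCoaffination σ) (hr : G.HasJoinedOrbits σ 3) :
    G.CliqueDivergent :=
  HasRank.cliqueDivergent (j := 0) ⟨‹_›, ‹_›, σ, h, hr⟩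

theorem iterCliqueGraph_cliqueGraph (G : SimpleGraph V) (n : ℕ) :
    iterCliqueGraph G.cliqueGraph n = iterCliqueGraph G (n + 1) := by
  induction n with
  | zero => rfl
  | succ n ih => rw [iterCliqueGraph, ih]; rfl

theorem CliqueDivergent.of_cliqueGraph {G : SimpleGraph V} (h : G.cliqueGraph.CliqueDivergent) :
    G.CliqueDivergent := by
  refine fun hfin => h (hfin.subset ?_)
  rintro _ ⟨n, rfl⟩
  exact ⟨n + 1, by simp only [iterCliqueGraph_cliqueGraph]⟩

/-- Three joined orbits in `K²` come from the stars of `c` and `v` and from the cliques that either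
contain `X` or contain `c` and meet `X`. The first kind in this third family meets translates of the
star of `c`, the second kind meets translates of the star of `v`. -/
theorem IsCoaffination.cliqueDivergent_of_dominating [Finite V] [Nonempty V] {G : SimpleGraph V}
    {σ : Equiv.Perm V} (h : G.IsCoaffination σ) {c v : V} {X : Set V} (hX : G.IsClique X)
    (hcX : ∀ x ∈ X, ∀ p q : ℤ, G.AdjOrEq ((σ ^ p) c) ((σ ^ q) x))
    (hcv : ∀ p q : ℤ, G.AdjOrEq ((σ ^ p) c) ((σ ^ q) v))
    (hv : ∀ q : ℤ, ∃ x ∈ X, G.AdjOrEq ((σ ^ q) v) x) : G.CliqueDivergent := by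
  obtain ⟨x₀, hx₀, -⟩ := hv 0
  refine (h.cliqueGraph.cliqueGraph.cliqueDivergent ?_).of_cliqueGraph.of_cliqueGraph
  refine h.cliqueGraph.hasJoinedOrbits_cliqueGraph
    ![{Q | c ∈ (Q : Set V)}, {Q | v ∈ (Q : Set V)},
      {Q | X ⊆ Q ∨ c ∈ (Q : Set V) ∧ ∃ x ∈ X, x ∈ (Q : Set V)}] (fun i => ?_) ?_
  · rw [isClique_iff_adjOrEq]
    fin_cases i
    · exact fun Q hQ R hR => cliqueGraph_adjOrEq hQ hR
    · exact fun Q hQ R hR => cliqueGraph_adjOrEq hQ hR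
    · rintro Q (hQ | ⟨hQ, x, hx, hxQ⟩) R (hR | ⟨hR, y, hy, hyR⟩)
      exacts [cliqueGraph_adjOrEq (hQ hx₀) (hR hx₀), cliqueGraph_adjOrEq (hQ hy) hyR,
        cliqueGraph_adjOrEq hxQ (hR hx), cliqueGraph_adjOrEq hQ hR]
  · have h01 : ∀ p q : ℤ, ∃ Q : {s : Set V // Maximal G.IsClique s},
        (σ ^ p) c ∈ (Q : Set V) ∧ (σ ^ q) v ∈ (Q : Set V) := fun p q =>
      have ⟨Q, h1, h2, _⟩ := exists_clique_triple (hcv p q) (hcv p q) (AdjOrEq.refl _)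
      ⟨Q, h1, h2⟩
    have h02 : ∀ p q : ℤ, ∃ Q : {s : Set V // Maximal G.IsClique s},
        (σ ^ p) c ∈ (Q : Set V) ∧ ∀ x ∈ X, (σ ^ q) x ∈ (Q : Set V) := by
      intro p q
      have : G.IsClique (insert ((σ ^ p) c) ((σ ^ q) '' X)) := by
        rw [isClique_iff_adjOrEq] at hX ⊢
        rintro _ (rfl | ⟨x, hx, rfl⟩) _ (rfl | ⟨y, hy, rfl⟩)
        exacts [AdjOrEq.refl _, hcX y hy p q, (hcX x hx p q).symm,
          (h.adjOrEq_zpow_iff q x y).2 (hX x hx y hy)]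
      obtain ⟨Q, hQ⟩ := exists_maximal_isClique this
      exact ⟨Q, hQ (by simp), fun x hx => hQ (Or.inr ⟨x, hx, rfl⟩)⟩
    have h12 : ∀ p q : ℤ, ∃ Q : {s : Set V // Maximal G.IsClique s},
        (σ ^ p) v ∈ (Q : Set V) ∧ (σ ^ q) c ∈ (Q : Set V) ∧
          ∃ x ∈ X, (σ ^ q) x ∈ (Q : Set V) := by
      intro p q
      -- Translating by `σ ^ (-q)` brings the required neighbour of `(σ ^ p) v` back into `X`
      -- itself.
      obtain ⟨x, hx, hvx⟩ := hv (-q + p)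
      rw [← h.adjOrEq_zpow_iff q, ← Equiv.Perm.mul_apply, ← zpow_add, add_neg_cancel_left] at hvx
      obtain ⟨Q, h1, h2, h3⟩ := exists_clique_triple (hcv q p) (hcX x hx q q) hvx
      exact ⟨Q, h2, h1, x, hx, h3⟩
    intro i j hij p q
    fin_cases i <;> fin_cases j <;> first | exact absurd hij (by decide) | skip
    · obtain ⟨Q, h1, h2⟩ := h01 p q
      refine ⟨Q, ?_, ?_⟩ <;> exact (h.mem_cliquePerm_zpow_neg_iff _).2 (by assumption)
    · obtain ⟨Q, h1, h2⟩ := h02 p q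
      refine ⟨Q, ?_, Or.inl fun x hx => ?_⟩
      · exact (h.mem_cliquePerm_zpow_neg_iff p).2 h1
      · exact (h.mem_cliquePerm_zpow_neg_iff q).2 (h2 x hx)
    · obtain ⟨Q, h1, h2, x, hx, h3⟩ := h12 p q
      refine ⟨Q, ?_, Or.inr ⟨?_, x, hx, ?_⟩⟩ <;> exact (h.mem_cliquePerm_zpow_neg_iff _).2 (by assumption)

end SimpleGraph

/-! ### Complements of a single long cycle -/

namespace SimpleGraph

variable {V : Type u} {G : SimpleGraph V} {σ : Equiv.Perm V}

/-- The dominating criterion is applied in `K(G)`. A clique `c` contains all even powers, so each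
translate contains a whole parity class and meets every clique with indices of both parities: the
translates of `v`, which contains 0 and 3, and of the members of `X`. Only adjacencies are assumed,
not the exact period, so that the lemma also serves an orbit of cliques. -/
theorem IsCoaffination.cliqueDivergent_of_even_coCycle [Finite V] [Nonempty V]
    (h : G.IsCoaffination σ) {m : ℤ} (hm : 5 ≤ m) (x : V)
    (hx : ∀ i j : ℤ, ¬ 2 * m ∣ i - j - 1 → ¬ 2 * m ∣ i - j + 1 →
      G.AdjOrEq ((σ ^ i) x) ((σ ^ j) x)) : G.CliqueDivergent := by
  have hd : ∀ a b : ℤ, 2 * m ∣ a → 2 * m ∣ b → a - b ≠ 0 → |a - b| < 10 → False :=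
    fun a b ha hb h0 hlt =>
      h0 (Int.eq_zero_of_abs_lt_dvd (dvd_sub ha hb) (by omega))
  have hpar : ∀ a : ℤ, 2 * m ∣ a → 2 ∣ a := fun a ha => (Dvd.intro m rfl).trans ha
  have hC : G.IsClique {y | ∃ i : ℤ, (σ ^ (2 * i)) x = y} := by
    rw [isClique_iff_adjOrEq]
    rintro _ ⟨i, rfl⟩ _ ⟨j, rfl⟩
    refine hx _ _ (fun hdvd => ?_) fun hdvd => ?_ <;> have := hpar _ hdvd <;> omega
  obtain ⟨c, hc⟩ := exists_maximal_isClique hC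
  have hc : ∀ p i : ℤ, 2 ∣ i - p → (σ ^ i) x ∈ ((h.cliquePerm ^ p) c : Set V) := by
    rintro p i ⟨k, hk⟩
    have := h.zpow_mem_cliquePerm_zpow p (hc ⟨k, rfl⟩)
    rwa [← Equiv.Perm.mul_apply, ← zpow_add, ← hk, add_sub_cancel] at this
  obtain ⟨v, hv0, hv3, -⟩ := exists_clique_triple (G := G) (x := (σ ^ (0 : ℤ)) x)
    (y := (σ ^ (3 : ℤ)) x)
    (hx 0 3 (fun h => hd _ 0 h (dvd_zero _) (by norm_num) (by norm_num))
      fun h => hd _ 0 h (dvd_zero _) (by norm_num) (by norm_num))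
    (hx 0 3 (fun h => hd _ 0 h (dvd_zero _) (by norm_num) (by norm_num))
      fun h => hd _ 0 h (dvd_zero _) (by norm_num) (by norm_num)) (AdjOrEq.refl _)
  have hv : ∀ q : ℤ, (σ ^ q) x ∈ ((h.cliquePerm ^ q) v : Set V) ∧
      (σ ^ (q + 3)) x ∈ ((h.cliquePerm ^ q) v : Set V) := by
    intro q
    have h0 := h.zpow_mem_cliquePerm_zpow q hv0
    have h3 := h.zpow_mem_cliquePerm_zpow q hv3
    rw [← Equiv.Perm.mul_apply, ← zpow_add] at h0 h3
    rw [add_zero] at h0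
    exact ⟨h0, h3⟩
  refine (h.cliqueGraph.cliqueDivergent_of_dominating (c := c) (v := v)
    (X := {Q | x ∈ (Q : Set V) ∧ ∃ i : ℤ, ¬ 2 ∣ i ∧ (σ ^ i) x ∈ (Q : Set V)})
    ?_ ?_ ?_ ?_).of_cliqueGraph
  · rw [isClique_iff_adjOrEq]
    exact fun Q hQ R hR => cliqueGraph_adjOrEq hQ.1 hR.1
  · rintro Q ⟨hQ, i, hi, hiQ⟩ p q
    have h0 := h.zpow_mem_cliquePerm_zpow q hQ
    have h1 := h.zpow_mem_cliquePerm_zpow q hiQ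
    rw [← Equiv.Perm.mul_apply, ← zpow_add] at h1
    by_cases hpq : 2 ∣ q - p
    · exact cliqueGraph_adjOrEq (hc p q hpq) h0
    · exact cliqueGraph_adjOrEq (hc p _ (by omega)) h1
  · intro p q
    by_cases hpq : 2 ∣ q - p
    · exact cliqueGraph_adjOrEq (hc p q hpq) (hv q).1
    · exact cliqueGraph_adjOrEq (hc p _ (by omega)) (hv q).2
  · intro q
    -- Indices `q` and `q + 3` cannot both be cyclically next to 0.
    obtain ⟨j, hj, hj1, hj2⟩ : ∃ j : ℤ, (σ ^ j) x ∈ ((h.cliquePerm ^ q) v : Set V) ∧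
        ¬ 2 * m ∣ 0 - j - 1 ∧ ¬ 2 * m ∣ 0 - j + 1 := by
      by_cases hq : ¬ 2 * m ∣ 0 - q - 1 ∧ ¬ 2 * m ∣ 0 - q + 1
      · exact ⟨q, (hv q).1, hq⟩
      · refine ⟨q + 3, (hv q).2, ?_⟩
        rw [not_and_or, not_not, not_not] at hq
        constructor <;> intro h' <;> rcases hq with hq | hq <;>
          exact hd _ _ hq h' (by ring_nf; norm_num) (by ring_nf; norm_num)
    -- An odd `k` is needed that is cyclically next to neither 0 nor `j`: 5 works unless `j` is 4 or
    -- 6 modulo `2 * m`, and then 7 or 3 does.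
    obtain ⟨k, hk, hk0, hk1, hk2⟩ : ∃ k : ℤ, ¬ 2 ∣ k ∧ (3 ≤ k ∧ k ≤ 7) ∧
        ¬ 2 * m ∣ j - k - 1 ∧ ¬ 2 * m ∣ j - k + 1 := by
      by_cases h4 : 2 * m ∣ j - 4
      · refine ⟨7, by norm_num, by norm_num, fun h' => ?_, fun h' => ?_⟩ <;>
          exact hd _ _ h4 h' (by ring_nf; norm_num) (by ring_nf; norm_num)
      by_cases h6 : 2 * m ∣ j - 6
      · refine ⟨3, by norm_num, by norm_num, fun h' => ?_, fun h' => ?_⟩ <;>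
          exact hd _ _ h6 h' (by ring_nf; norm_num) (by ring_nf; norm_num)
      · refine ⟨5, by norm_num, by norm_num, fun h' => h6 ?_, fun h' => h4 ?_⟩ <;>
          convert h' using 1 <;> ring
    obtain ⟨Q, h1, h2, h3⟩ := exists_clique_triple (hx 0 j hj1 hj2)
      (hx 0 k (fun h' => hd _ 0 h' (dvd_zero _) (by omega) (by rw [abs_lt]; omega))
        fun h' => hd _ 0 h' (dvd_zero _) (by omega) (by rw [abs_lt]; omega)) (hx j k hk1 hk2)
    exact ⟨Q, ⟨h1, k, hk, h3⟩, cliqueGraph_adjOrEq hj h2⟩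

/-- Halve indices modulo `2 * m + 1`. Then `v` contains a window of `m` consecutive residues, and
the indices 0, 3, 6 in `c` become 0, `m + 2`, 3, with cyclic gaps 3, `m - 1`, `m - 1`; hence every
window of length `m` meets every translate of `c`. The bound `4 ≤ m` keeps 0 and 6 from being
neighbours on the cycle. -/
theorem IsCoaffination.cliqueDivergent_of_odd_coCycle [Finite V] [Nonempty V]
    (h : G.IsCoaffination σ) {m : ℤ} (hm : 4 ≤ m) (x : V)
    (hper : ∀ i j : ℤ, 2 * m + 1 ∣ i - j → (σ ^ i) x = (σ ^ j) x)
    (hx : ∀ i j : ℤ, ¬ 2 * m + 1 ∣ i - j - 1 → ¬ 2 * m + 1 ∣ i - j + 1 →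
      G.AdjOrEq ((σ ^ i) x) ((σ ^ j) x)) : G.CliqueDivergent := by
  have hd : ∀ a : ℤ, 2 * m + 1 ∣ a → a ≠ 0 → |a| < 2 * m + 1 → False :=
    fun a ha h0 hlt => h0 (Int.eq_zero_of_abs_lt_dvd ha hlt)
  -- The inverse of 2 modulo `2 * m + 1` is `m + 1`.
  have half : ∀ d : ℤ, ∃ e a : ℤ, 2 * e = d + (2 * m + 1) * a ∧ 0 ≤ e ∧ e < 2 * m + 1 := by
    intro d
    refine ⟨(d * (m + 1)) % (2 * m + 1), d - 2 * (d * (m + 1) / (2 * m + 1)), ?_,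
      Int.emod_nonneg _ (by omega), Int.emod_lt_of_pos _ (by omega)⟩
    linear_combination 2 * Int.emod_add_mul_ediv (d * (m + 1)) (2 * m + 1)
  have hC : G.IsClique {y | ∃ k : ℤ, 0 ≤ k ∧ k < m ∧ (σ ^ (2 * k)) x = y} := by
    rw [isClique_iff_adjOrEq]
    rintro _ ⟨i, hi0, hi, rfl⟩ _ ⟨j, hj0, hj, rfl⟩
    refine hx _ _ (fun h' => hd _ h' ?_ ?_) fun h' => hd _ h' ?_ ?_
    all_goals first | omega | (rw [abs_lt]; omega)
  obtain ⟨v, hv⟩ := exists_maximal_isClique hC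
  have hv : ∀ q k : ℤ, 0 ≤ k → k < m →
      (σ ^ (q + 2 * k)) x ∈ ((h.cliquePerm ^ q) v : Set V) := by
    intro q k h0 h1
    have := h.zpow_mem_cliquePerm_zpow q (hv ⟨k, h0, h1, rfl⟩)
    rwa [← Equiv.Perm.mul_apply, ← zpow_add] at this
  obtain ⟨c, hc0, hc3, hc6⟩ : ∃ Q : {s : Set V // Maximal G.IsClique s},
      (σ ^ (0 : ℤ)) x ∈ (Q : Set V) ∧ (σ ^ (3 : ℤ)) x ∈ (Q : Set V) ∧
      (σ ^ (6 : ℤ)) x ∈ (Q : Set V) := by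
    apply exists_clique_triple
    all_goals
      refine hx _ _ (fun h' => hd _ h' ?_ ?_) fun h' => hd _ h' ?_ ?_
      all_goals first | omega | (rw [abs_lt]; omega)
  have hcv : ∀ p q : ℤ,
      G.cliqueGraph.AdjOrEq ((h.cliquePerm ^ p) c) ((h.cliquePerm ^ q) v) := by
    intro p q
    have h0 := h.zpow_mem_cliquePerm_zpow p hc0
    have h3 := h.zpow_mem_cliquePerm_zpow p hc3
    have h6 := h.zpow_mem_cliquePerm_zpow p hc6
    rw [← Equiv.Perm.mul_apply, ← zpow_add] at h0 h3 h6
    obtain ⟨e, a, he, he0, he1⟩ := half (p - q)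
    -- Relative to the window at `q`, the halved positions of `p`, `p + 3`, `p + 6` are `e`, `e - m
    -- + 1`, `e - 2 * m + 2`; one of them lies in `[0, m)`.
    rcases lt_or_ge e m with hlt | hge
    · rw [hper (p + 0) (q + 2 * e) ⟨-a, by linear_combination -he⟩] at h0
      exact cliqueGraph_adjOrEq h0 (hv q _ he0 hlt)
    rcases lt_or_ge e (2 * m - 2) with hlt | hge'
    · rw [hper (p + 3) (q + 2 * (e - m + 1)) ⟨-a + 1, by linear_combination -he⟩] at h3
      exact cliqueGraph_adjOrEq h3 (hv q _ (by omega) (by omega))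
    · rw [hper (p + 6) (q + 2 * (e - 2 * m + 2)) ⟨-a + 2, by linear_combination -he⟩] at h6
      exact cliqueGraph_adjOrEq h6 (hv q _ (by omega) (by omega))
  refine (h.cliqueGraph.cliqueDivergent_of_dominating (c := c) (v := v)
    (X := {Q | ∃ j : ℤ, 0 ≤ j ∧ j ≤ 2 ∧ (h.cliquePerm ^ (2 * j)) v = Q})
    ?_ ?_ hcv ?_).of_cliqueGraph
  · rw [isClique_iff_adjOrEq]
    have : ∀ j : ℤ, 0 ≤ j → j ≤ 2 →
        (σ ^ (4 : ℤ)) x ∈ ((h.cliquePerm ^ (2 * j)) v : Set V) := by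
      intro j h0 h2
      have := hv (2 * j) (2 - j) (by omega) (by omega)
      rwa [show 2 * j + 2 * (2 - j) = 4 by ring] at this
    rintro _ ⟨i, hi0, hi2, rfl⟩ _ ⟨j, hj0, hj2, rfl⟩
    exact cliqueGraph_adjOrEq (this i hi0 hi2) (this j hj0 hj2)
  · rintro _ ⟨j, -, -, rfl⟩ p q
    rw [← Equiv.Perm.mul_apply, ← zpow_add]
    exact hcv p _
  · intro q
    -- Two windows of length `m` are disjoint only at shift `m` or `m + 1`; moving the fixed window
    -- by 1 or 2 repairs these cases.
    obtain ⟨j, k, l, hj0, hj2, hk0, hk, hl0, hl, hdvd⟩ : ∃ j k l : ℤ, 0 ≤ j ∧ j ≤ 2 ∧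
        0 ≤ k ∧ k < m ∧ 0 ≤ l ∧ l < m ∧ 2 * m + 1 ∣ q + 2 * k - (2 * j + 2 * l) := by
      obtain ⟨e, a, he, he0, he1⟩ := half q
      rcases lt_or_ge e m with hlt | hge
      · exact ⟨0, 0, e, by omega, by omega, by omega, by omega, by omega, by omega, -a,
          by linear_combination -he⟩
      by_cases h1 : e = m
      · exact ⟨1, 0, m - 1, by omega, by omega, by omega, by omega, by omega, by omega, -a,
          by linear_combination -he + 2 * h1⟩
      by_cases h2 : e = m + 1
      · exact ⟨2, 0, m - 1, by omega, by omega, by omega, by omega, by omega, by omega, -a,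
          by linear_combination -he + 2 * h2⟩
      · exact ⟨0, 2 * m + 1 - e, 0, by omega, by omega, by omega, by omega, by omega, by omega,
          2 - a, by linear_combination -he⟩
    refine ⟨_, ⟨j, hj0, hj2, rfl⟩, cliqueGraph_adjOrEq (hv q k hk0 hk) ?_⟩
    rw [hper _ _ hdvd]
    exact hv _ l hl0 hl

end SimpleGraph

/-! ### Orienting the cycles of a 2-regular graph -/

namespace SimpleGraph

variable {V : Type u} {G : SimpleGraph V}

/-- In a 2-regular graph a neighbour `u` of `v` determines the other one. -/
theorem IsRegularOfDegree.exists_other_neighbor [G.LocallyFinite] (hG : G.IsRegularOfDegree 2)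
    {u v : V} (h : G.Adj u v) :
    ∃ w, w ≠ u ∧ G.Adj v w ∧ ∀ z, G.Adj v z → z = u ∨ z = w := by
  have hu : u ∈ G.neighborFinset v := by simpa using h.symm
  classical
  obtain ⟨a, b, hab, he⟩ := Finset.card_eq_two.1 (hG v)
  have hv : ∀ z, G.Adj v z ↔ z = a ∨ z = b := fun z => by
    rw [← mem_neighborFinset, he]
    simp
  rcases (hv u).1 h.symm with rfl | rfl
  · exact ⟨b, hab.symm, (hv b).2 (Or.inr rfl), fun z hz => (hv z).1 hz⟩
  · exact ⟨a, hab, (hv a).2 (Or.inl rfl), fun z hz => ((hv z).1 hz).symm⟩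

/-- Every edge of a 2-regular graph lies on a two-way infinite non-backtracking walk. -/
theorem IsRegularOfDegree.exists_line [G.LocallyFinite] (hG : G.IsRegularOfDegree 2) (v : V) :
    ∃ f : ℤ → V, f 0 = v ∧ (∀ k, G.Adj (f k) (f (k + 1))) ∧ ∀ k, f k ≠ f (k + 2) := by
  choose w hw1 hw2 hw3 using fun d : {d : V × V // G.Adj d.1 d.2} =>
    hG.exists_other_neighbor d.2
  -- Advancing a directed edge without backtracking is invertible: reverse, advance, reverse.
  let φ : Equiv.Perm {d : V × V // G.Adj d.1 d.2} :=
    { toFun := fun d => ⟨(d.1.2, w d), hw2 d⟩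
      invFun := fun d => ⟨(w ⟨(d.1.2, d.1.1), d.2.symm⟩, d.1.1),
        (hw2 ⟨(d.1.2, d.1.1), d.2.symm⟩).symm⟩
      left_inv := fun d => by
        have h1 := hw1 ⟨(w d, d.1.2), (hw2 d).symm⟩
        have h2 := hw3 d _ (hw2 ⟨(w d, d.1.2), (hw2 d).symm⟩)
        exact Subtype.ext (Prod.ext (h2.resolve_right h1) rfl)
      right_inv := fun d => by
        have h1 := hw1 ⟨(w ⟨(d.1.2, d.1.1), d.2.symm⟩, d.1.1),
          (hw2 ⟨(d.1.2, d.1.1), d.2.symm⟩).symm⟩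
        have h2 := hw3 ⟨(d.1.2, d.1.1), d.2.symm⟩ _
          (hw2 ⟨(w ⟨(d.1.2, d.1.1), d.2.symm⟩, d.1.1),
            (hw2 ⟨(d.1.2, d.1.1), d.2.symm⟩).symm⟩)
        exact Subtype.ext (Prod.ext rfl (h2.resolve_right h1)) }
  obtain ⟨u, hu⟩ : ∃ u, G.Adj v u := by
    have : (G.neighborFinset v).Nonempty := by
      rw [← Finset.card_pos, card_neighborFinset_eq_degree, hG v]
      exact two_pos
    obtain ⟨u, hu⟩ := this
    exact ⟨u, by simpa using hu⟩
  let d : ℤ → {d : V × V // G.Adj d.1 d.2} := fun k => (φ ^ k) ⟨(v, u), hu⟩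
  have hd : ∀ k, d (k + 1) = φ (d k) := fun k => by
    simp only [d]
    rw [add_comm, zpow_one_add, Equiv.Perm.mul_apply]
  have hd1 : ∀ k, (d (k + 1)).1.1 = (d k).1.2 := fun k => by rw [hd]; rfl
  refine ⟨fun k => (d k).1.1, rfl, fun k => ?_, fun k => ?_⟩
  · change G.Adj (d k).1.1 (d (k + 1)).1.1
    rw [hd1]
    exact (d k).2
  · change (d k).1.1 ≠ (d (k + 2)).1.1
    rw [show k + 2 = k + 1 + 1 by ring, hd1, hd]
    exact (hw1 (d k)).symm

/-- A 2-regular graph is the union of the cycles of a permutation. -/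
theorem IsRegularOfDegree.exists_rotation [Finite V] [G.LocallyFinite]
    (hG : G.IsRegularOfDegree 2) :
    ∃ σ : Equiv.Perm V, ∀ u v, G.Adj u v ↔ v = σ u ∨ u = σ v := by
  choose f hf0 hf1 hf2 using fun C : G.ConnectedComponent => hG.exists_line C.out
  have hn : ∀ C k z, G.Adj (f C k) z → z = f C (k - 1) ∨ z = f C (k + 1) := by
    intro C k z hz
    have h1 := hf1 C (k - 1)
    have h2 := hf1 C k
    have h3 := hf2 C (k - 1)
    rw [sub_add_cancel] at h1
    rw [show k - 1 + 2 = k + 1 by ring] at h3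
    obtain ⟨w, -, -, hw⟩ := hG.exists_other_neighbor h1
    rcases hw z hz with rfl | rfl
    · exact Or.inl rfl
    · exact Or.inr ((hw _ h2).resolve_left h3.symm).symm
  have hstep : ∀ C i j, f C i = f C j → f C (i + 1) = f C (j + 1) := by
    intro C i j hij
    -- The successor along the line depends only on the vertex. Otherwise the line would retrace
    -- itself backwards between `i` and `j`, and around the midpoint it would backtrack or contain a
    -- loop, according to the parity of `j - i`.
    refine (hn C j _ (hij ▸ hf1 C i)).resolve_left fun hrev => ?_
    have hback : ∀ k : ℤ, f C (i + k) = f C (j - k) ∧ f C (i + k + 1) = f C (j - k - 1) := by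
      intro k
      induction k with
      | zero => simpa using ⟨hij, hrev⟩
      | succ k ih =>
        refine ⟨by simpa [add_assoc, sub_sub] using ih.2, ?_⟩
        have h1 := hf1 C (i + k + 1)
        rw [ih.2] at h1
        rcases hn C _ _ h1 with h2 | h2
        · rwa [← add_assoc, ← sub_sub]
        · refine absurd ?_ (hf2 C (i + k))
          rw [show i + (k : ℤ) + 2 = i + k + 1 + 1 by ring, h2, ih.1]
          congr 1
          ring
      | pred k ih =>
        have h1 : G.Adj (f C (i + -k)) (f C (i + -k - 1)) := by
          simpa using (hf1 C (i + -k - 1)).symm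
        refine ⟨?_, by convert ih.1 using 2 <;> ring⟩
        rw [ih.1] at h1
        rcases hn C _ _ h1 with h2 | h2
        · refine absurd ?_ (hf2 C (i + -k - 1))
          rw [show i + -(k : ℤ) - 1 + 2 = i + -k + 1 by ring, ih.2, h2]
        · convert h2 using 2 <;> ring
    rcases Int.even_or_odd' (j - i) with ⟨m, hm | hm⟩
    · have := (hback (m - 1)).1
      rw [show j - (m - 1) = i + (m - 1) + 2 by linarith] at this
      exact hf2 C _ this
    · have := (hback m).1
      rw [show j - m = i + m + 1 by linarith] at this
      exact (hf1 C (i + m)).ne this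
  have hcover : ∀ C u, G.connectedComponentMk u = C → ∃ i, f C i = u := by
    intro C u hu
    have hreach : G.Reachable C.out u := by
      rw [← ConnectedComponent.eq, hu]
      exact C.out_eq
    obtain ⟨p⟩ := hreach
    have : ∀ a b : V, G.Walk a b → (∃ i, f C i = a) → ∃ i, f C i = b := by
      intro a b p
      induction p with
      | nil => exact id
      | cons hab _ ih =>
        rintro ⟨i, rfl⟩
        rcases hn C i _ hab with rfl | rfl
        · exact ih ⟨_, rfl⟩
        · exact ih ⟨_, rfl⟩
    exact this _ _ p ⟨0, hf0 C⟩
  choose ind hind using fun u => hcover (G.connectedComponentMk u) u rfl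
  let s : V → V := fun u => f (G.connectedComponentMk u) (ind u + 1)
  have hadj : ∀ u, G.Adj u (s u) := fun u => by
    have := hf1 (G.connectedComponentMk u) (ind u)
    rwa [hind] at this
  have hcomp : ∀ u v, G.Adj u v → G.connectedComponentMk v = G.connectedComponentMk u :=
    fun u v huv => ConnectedComponent.sound huv.symm.reachable
  have hs : ∀ C i, G.connectedComponentMk (f C i) = C → s (f C i) = f C (i + 1) := by
    intro C i hC
    have h1 := hind (f C i)
    simp only [s]
    rw [hC] at h1 ⊢
    exact hstep C _ _ h1
  have hiff : ∀ u v, G.Adj u v ↔ v = s u ∨ u = s v := by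
    refine fun u v => ⟨fun huv => ?_, ?_⟩
    · have h1 := hcomp u v huv
      have h2 := hind u
      set C := G.connectedComponentMk u with hC
      have h3 := huv
      rw [← h2] at h3
      rcases hn C _ _ h3 with h4 | h4
      · right
        have := hs C (ind u - 1) (by rw [← h4, h1])
        rw [← h4, sub_add_cancel, h2] at this
        exact this.symm
      · left
        have := hs C (ind u) (by rw [h2])
        rwa [h2, ← h4, eq_comm] at this
    · rintro (rfl | rfl)
      exacts [hadj u, (hadj v).symm]
  have hsurj : Function.Surjective s := by
    intro u
    have h2 := hind u
    have h3 := (hf1 (G.connectedComponentMk u) (ind u - 1)).symm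
    rw [sub_add_cancel, h2] at h3
    refine ⟨_, (hs _ (ind u - 1) (hcomp _ _ h3)).trans ?_⟩
    rw [sub_add_cancel, h2]
  exact ⟨Equiv.ofBijective s (Finite.injective_iff_bijective.1
    (Finite.injective_iff_surjective.2 hsurj)), hiff⟩

end SimpleGraph

/-! ### Cycle structure of `G` and the case analysis -/

namespace SimpleGraph

variable {V : Type u} {G : SimpleGraph V} {σ : Equiv.Perm V}

theorem compl_adjOrEq_iff {x y : V} : Gᶜ.AdjOrEq x y ↔ ¬ G.Adj x y := by
  by_cases e : x = y
  · simp [AdjOrEq, e]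
  · simp [AdjOrEq, e]

theorem isCoaffination_compl (hadj : ∀ u v, G.Adj u v ↔ v = σ u ∨ u = σ v) :
    Gᶜ.IsCoaffination σ where
  adj_iff x y := by simp [hadj]
  not_adjOrEq x := by simp [compl_adjOrEq_iff, hadj]

theorem compl_adjOrEq_of_not_sameCycle (hadj : ∀ u v, G.Adj u v ↔ v = σ u ∨ u = σ v) {u v : V}
    (huv : ¬ σ.SameCycle u v) (p q : ℤ) : Gᶜ.AdjOrEq ((σ ^ p) u) ((σ ^ q) v) := by
  rw [compl_adjOrEq_iff, hadj]
  rintro (h | h) <;> apply huv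
  · rw [← Equiv.Perm.mul_apply, ← zpow_one_add] at h
    rw [← Equiv.Perm.sameCycle_zpow_right (n := q), h, Equiv.Perm.sameCycle_zpow_right]
  · rw [← Equiv.Perm.mul_apply, ← zpow_one_add] at h
    rw [← Equiv.Perm.sameCycle_zpow_left (n := p), h, Equiv.Perm.sameCycle_zpow_left]

theorem zpow_apply_eq_iff (σ : Equiv.Perm V) (x : V) (i j : ℤ) :
    (σ ^ i) x = (σ ^ j) x ↔ (Function.minimalPeriod σ x : ℤ) ∣ i - j := by
  have h : (σ ^ (i - j)) x = x ↔ (Function.minimalPeriod σ x : ℤ) ∣ i - j :=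
    MulAction.zpow_smul_eq_iff_minimalPeriod_dvd (a := σ) (b := x)
  rw [← h, show i - j = -j + i by ring, zpow_add, Equiv.Perm.mul_apply, zpow_neg,
    Equiv.Perm.inv_eq_iff_eq]

theorem zpow_adj_zpow_iff (hadj : ∀ u v, G.Adj u v ↔ v = σ u ∨ u = σ v) (x : V) (i j : ℤ) :
    G.Adj ((σ ^ i) x) ((σ ^ j) x) ↔ (Function.minimalPeriod σ x : ℤ) ∣ i - j - 1 ∨
      (Function.minimalPeriod σ x : ℤ) ∣ i - j + 1 := by
  rw [hadj, ← Equiv.Perm.mul_apply, ← Equiv.Perm.mul_apply, ← zpow_one_add, ← zpow_one_add,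
    eq_comm, zpow_apply_eq_iff, zpow_apply_eq_iff, or_comm]
  ring_nf

theorem compl_zpow_adjOrEq_zpow (hadj : ∀ u v, G.Adj u v ↔ v = σ u ∨ u = σ v) (x : V) {n : ℤ}
    (hn : Function.minimalPeriod σ x = n) {i j : ℤ} (h1 : ¬ n ∣ i - j - 1) (h2 : ¬ n ∣ i - j + 1) :
    Gᶜ.AdjOrEq ((σ ^ i) x) ((σ ^ j) x) := by
  subst hn
  rw [compl_adjOrEq_iff, zpow_adj_zpow_iff hadj]
  exact not_or.2 ⟨h1, h2⟩

theorem exists_pow_eq_of_sameCycle [Finite V] {x y : V} (h : σ.SameCycle x y) :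
    ∃ i : Fin (Function.minimalPeriod σ x), (σ ^ (i : ℤ)) x = y := by
  obtain ⟨k, rfl⟩ := h
  have hpos : 0 < Function.minimalPeriod σ x :=
    Function.minimalPeriod_pos_of_mem_periodicPts
      (σ.injective.mem_periodicPts x)
  have h0 := Int.emod_nonneg k (Int.natCast_ne_zero.2 hpos.ne')
  have h1 := Int.emod_lt_of_pos k (Int.natCast_pos.2 hpos)
  refine ⟨⟨(k % Function.minimalPeriod σ x).toNat, by omega⟩, ?_⟩
  rw [zpow_apply_eq_iff]
  simp only [Int.toNat_of_nonneg h0]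
  exact dvd_sub_comm.1 (Int.dvd_self_sub_emod)

theorem cliqueDivergent_of_minimalPeriod [Finite V] [Nonempty V]
    (hadj : ∀ u v, G.Adj u v ↔ v = σ u ∨ u = σ v) (x : V)
    (hn : 9 ≤ Function.minimalPeriod σ x) : Gᶜ.CliqueDivergent := by
  have h := isCoaffination_compl hadj
  rcases Nat.even_or_odd' (Function.minimalPeriod σ x) with ⟨m, hm | hm⟩
  · exact h.cliqueDivergent_of_even_coCycle (m := m) (by omega) x fun i j h1 h2 =>
      compl_zpow_adjOrEq_zpow hadj x (by rw [hm]; norm_num) h1 h2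
  · have hm' : (Function.minimalPeriod σ x : ℤ) = 2 * m + 1 := by rw [hm]; norm_num
    exact h.cliqueDivergent_of_odd_coCycle (m := m) (by omega) x
      (fun i j hij => (zpow_apply_eq_iff σ x i j).2 (hm' ▸ hij)) fun i j h1 h2 =>
      compl_zpow_adjOrEq_zpow hadj x hm' h1 h2

/-- The sets `{x_i, x_{i+2}, y_j, y_{j+2}}` for two cycles. -/
theorem exists_clique_of_two_cycles [Finite V] (hadj : ∀ u v, G.Adj u v ↔ v = σ u ∨ u = σ v)
    {x y : V} (hxy : ¬ σ.SameCycle x y) (hx : 4 ≤ Function.minimalPeriod σ x)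
    (hy : 4 ≤ Function.minimalPeriod σ y) (i j : ℤ) :
    ∃ Q : {s : Set V // Maximal Gᶜ.IsClique s},
      (σ ^ i) x ∈ (Q : Set V) ∧ (σ ^ (i + 2)) x ∈ (Q : Set V) ∧
      (σ ^ j) y ∈ (Q : Set V) ∧ (σ ^ (j + 2)) y ∈ (Q : Set V) := by
  have key : ∀ z, 4 ≤ Function.minimalPeriod σ z → ∀ k : ℤ,
      Gᶜ.AdjOrEq ((σ ^ k) z) ((σ ^ (k + 2)) z) := by
    intro z hz k
    refine compl_zpow_adjOrEq_zpow hadj z rfl (fun h => ?_) fun h => ?_ <;>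
      have := Int.eq_zero_of_abs_lt_dvd h (by rw [abs_lt]; omega) <;> omega
  have hx := key x hx i
  have hy := key y hy j
  have hc := compl_adjOrEq_of_not_sameCycle hadj hxy
  have : Gᶜ.IsClique ({(σ ^ i) x, (σ ^ (i + 2)) x, (σ ^ j) y, (σ ^ (j + 2)) y} : Set V) := by
    rw [isClique_iff_adjOrEq]
    simp only [Set.mem_insert_iff, Set.mem_singleton_iff]
    rintro a (rfl | rfl | rfl | rfl) b (rfl | rfl | rfl | rfl) <;>
      first
      | exact AdjOrEq.refl _ | exact hx | exact hy | exact hc _ _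
      | exact hx.symm | exact hy.symm | exact (hc _ _).symm
  obtain ⟨Q, hQ⟩ := exists_maximal_isClique this
  exact ⟨Q, hQ (by simp), hQ (by simp), hQ (by simp), hQ (by simp)⟩

/-- Translates `i` and `j` of a clique containing `x_0, x_2, y_0, y_2` meet when `i - j` is even
(via the 4-cycle) or is 0 or ±2 modulo 5. What remains is `i - j` congruent to ±1 modulo 10, so this
orbit behaves like the complement of a 10-cycle. -/
theorem cliqueDivergent_of_four_five [Finite V] [Nonempty V]
    (hadj : ∀ u v, G.Adj u v ↔ v = σ u ∨ u = σ v) {x y : V} (hxy : ¬ σ.SameCycle x y)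
    (hx : Function.minimalPeriod σ x = 4) (hy : Function.minimalPeriod σ y = 5) :
    Gᶜ.CliqueDivergent := by
  have h := isCoaffination_compl hadj
  obtain ⟨Q, hx0, hx2, hy0, hy2⟩ := exists_clique_of_two_cycles hadj hxy hx.ge (by omega) 0 0
  have mem : ∀ {z : V} {k : ℤ}, (σ ^ k) z ∈ (Q : Set V) → ∀ p i : ℤ,
      (Function.minimalPeriod σ z : ℤ) ∣ i - (p + k) →
      (σ ^ i) z ∈ ((h.cliquePerm ^ p) Q : Set V) := by
    intro z k hk p i hi
    have := h.zpow_mem_cliquePerm_zpow p hk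
    rw [← Equiv.Perm.mul_apply, ← zpow_add] at this
    rwa [(zpow_apply_eq_iff σ z _ _).2 hi]
  refine (h.cliqueGraph.cliqueDivergent_of_even_coCycle (m := 5) le_rfl Q
    fun i j h1 h2 => ?_).of_cliqueGraph
  by_cases c0 : (4 : ℤ) ∣ j - i
  · exact cliqueGraph_adjOrEq (mem hx0 i j (by rw [hx]; omega)) (mem hx0 j j (by rw [hx]; omega))
  by_cases c1 : (4 : ℤ) ∣ j - (i + 2)
  · exact cliqueGraph_adjOrEq (mem hx2 i j (by rw [hx]; omega)) (mem hx0 j j (by rw [hx]; omega))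
  by_cases c2 : (5 : ℤ) ∣ j - i
  · exact cliqueGraph_adjOrEq (mem hy0 i j (by rw [hy]; omega)) (mem hy0 j j (by rw [hy]; omega))
  by_cases c3 : (5 : ℤ) ∣ j - (i + 2)
  · exact cliqueGraph_adjOrEq (mem hy2 i j (by rw [hy]; omega)) (mem hy0 j j (by rw [hy]; omega))
  · have h5 : (i - j) % 5 = 0 ∨ (i - j) % 5 = 1 ∨ (i - j) % 5 = 2 ∨ (i - j) % 5 = 3 ∨
      (i - j) % 5 = 4 := by omega
    have h2' : (i - j) % 5 = 2 := by
      rcases h5 with h5 | h5 | h5 | h5 | h5 <;> omega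
    exact cliqueGraph_adjOrEq (mem hy0 i i (by rw [hy]; omega)) (mem hy2 j i (by rw [hy]; omega))

theorem cliqueDivergent_of_five_five [Finite V] [Nonempty V]
    (hadj : ∀ u v, G.Adj u v ↔ v = σ u ∨ u = σ v) {x y : V} (hxy : ¬ σ.SameCycle x y)
    (hx : Function.minimalPeriod σ x = 5) (hy : Function.minimalPeriod σ y = 5) :
    Gᶜ.CliqueDivergent := by
  have h := isCoaffination_compl hadj
  -- Doubling the second index makes the `Q i` pairwise meet: index differences 0 and ±2 modulo 5
  -- are caught on the first cycle, ±1 on the second.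
  choose Q hx0 hx2 hy0 hy2 using fun i : ℤ =>
    exists_clique_of_two_cycles hadj hxy (by omega) (by omega) i (2 * i)
  have memx : ∀ {k : ℤ} {R : {s : Set V // Maximal Gᶜ.IsClique s}}, (σ ^ k) x ∈ (R : Set V) →
      ∀ i : ℤ, 5 ∣ i - k → (σ ^ i) x ∈ (R : Set V) := by
    intro k R hk i hi
    rwa [(zpow_apply_eq_iff σ x i k).2 (by rwa [hx])]
  have memy : ∀ {k : ℤ} {R : {s : Set V // Maximal Gᶜ.IsClique s}}, (σ ^ k) y ∈ (R : Set V) →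
      ∀ i : ℤ, 5 ∣ i - k → (σ ^ i) y ∈ (R : Set V) := by
    intro k R hk i hi
    rwa [(zpow_apply_eq_iff σ y i k).2 (by rwa [hy])]
  refine (h.cliqueGraph.cliqueGraph.cliqueDivergent ?_).of_cliqueGraph.of_cliqueGraph
  refine h.cliqueGraph.hasJoinedOrbits_cliqueGraph
    ![{R | x ∈ (R : Set V)}, {R | y ∈ (R : Set V)}, Set.range Q] (fun i => ?_) ?_
  · rw [isClique_iff_adjOrEq]
    fin_cases i
    · exact fun Q hQ R hR => cliqueGraph_adjOrEq hQ hR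
    · exact fun Q hQ R hR => cliqueGraph_adjOrEq hQ hR
    · rintro _ ⟨i, rfl⟩ _ ⟨j, rfl⟩
      by_cases c0 : (5 : ℤ) ∣ j - i
      · exact cliqueGraph_adjOrEq (memx (hx0 i) j (by omega)) (hx0 j)
      by_cases c1 : (5 : ℤ) ∣ j - (i + 2)
      · exact cliqueGraph_adjOrEq (memx (hx2 i) j (by omega)) (hx0 j)
      by_cases c2 : (5 : ℤ) ∣ i - (j + 2)
      · exact cliqueGraph_adjOrEq (hx0 i) (memx (hx2 j) i (by omega))
      by_cases c3 : (5 : ℤ) ∣ j - (i + 1)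
      · exact cliqueGraph_adjOrEq (memy (hy2 i) (2 * j) (by omega)) (hy0 j)
      · have h5 : (i - j) % 5 = 0 ∨ (i - j) % 5 = 1 ∨ (i - j) % 5 = 2 ∨ (i - j) % 5 = 3 ∨
        (i - j) % 5 = 4 := by omega
        have h1 : (i - j) % 5 = 1 := by
          rcases h5 with h5 | h5 | h5 | h5 | h5 <;> omega
        exact cliqueGraph_adjOrEq (hy0 i) (memy (hy2 j) (2 * i) (by omega))
  · intro i j hij p q
    fin_cases i <;> fin_cases j <;> first | exact absurd hij (by decide) | skip
    · obtain ⟨R, h1, -, h2, -⟩ :=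
        exists_clique_of_two_cycles hadj hxy (by omega) (by omega) p q
      exact ⟨R, (h.mem_cliquePerm_zpow_neg_iff p).2 h1, (h.mem_cliquePerm_zpow_neg_iff q).2 h2⟩
    · refine ⟨(h.cliquePerm ^ q) (Q (p - q)), (h.mem_cliquePerm_zpow_neg_iff p).2 ?_,
        p - q, by simp⟩
      rw [h.mem_cliquePerm_zpow_iff, ← Equiv.Perm.mul_apply, ← zpow_add]
      exact memx (hx0 _) _ (by omega)
    -- The factor 3 is the inverse of 2 modulo 5, undoing the doubled index.
    · refine ⟨(h.cliquePerm ^ q) (Q (3 * (p - q))), (h.mem_cliquePerm_zpow_neg_iff p).2 ?_,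
        3 * (p - q), by simp⟩
      rw [h.mem_cliquePerm_zpow_iff, ← Equiv.Perm.mul_apply, ← zpow_add]
      exact memy (hy0 _) _ (by omega)

/-- The dominating criterion applies with `c` on the other cycle and `X` consisting of `x_0, x_2,
x_4`: a vertex has only two neighbours on its cycle, so it is nonadjacent in `G` to one of these
three. -/
theorem cliqueDivergent_of_six_le [Finite V] [Nonempty V]
    (hadj : ∀ u v, G.Adj u v ↔ v = σ u ∨ u = σ v) {x y : V} (hxy : ¬ σ.SameCycle x y)
    (hx : 6 ≤ Function.minimalPeriod σ x) : Gᶜ.CliqueDivergent := by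
  have h := isCoaffination_compl hadj
  have hc : ∀ p q : ℤ, Gᶜ.AdjOrEq ((σ ^ p) y) ((σ ^ q) x) :=
    compl_adjOrEq_of_not_sameCycle hadj fun e => hxy e.symm
  have hd : ∀ a : ℤ, (Function.minimalPeriod σ x : ℤ) ∣ a → a ≠ 0 → |a| < 6 → False :=
    fun a ha h0 hlt => h0 (Int.eq_zero_of_abs_lt_dvd ha (by omega))
  refine h.cliqueDivergent_of_dominating (c := y) (v := x)
    (X := {z | ∃ i : ℤ, 0 ≤ i ∧ i ≤ 2 ∧ (σ ^ (2 * i)) x = z}) ?_ ?_ hc ?_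
  · rw [isClique_iff_adjOrEq]
    rintro _ ⟨i, hi0, hi2, rfl⟩ _ ⟨j, hj0, hj2, rfl⟩
    refine compl_zpow_adjOrEq_zpow hadj x rfl (fun h' => hd _ h' ?_ ?_) fun h' => hd _ h' ?_ ?_
    all_goals first | omega | (rw [abs_lt]; omega)
  · rintro _ ⟨i, -, -, rfl⟩ p q
    rw [← Equiv.Perm.mul_apply, ← zpow_add]
    exact hc p _
  · intro q
    by_contra! hno
    have hdvd : ∀ i : ℤ, 0 ≤ i → i ≤ 2 →
        (Function.minimalPeriod σ x : ℤ) ∣ q - 2 * i - 1 ∨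
        (Function.minimalPeriod σ x : ℤ) ∣ q - 2 * i + 1 := by
      intro i hi0 hi2
      rw [← zpow_adj_zpow_iff hadj]
      by_contra hn
      exact hno _ ⟨i, hi0, hi2, rfl⟩ (compl_adjOrEq_iff.2 hn)
    have hdd : ∀ a b : ℤ, (Function.minimalPeriod σ x : ℤ) ∣ a →
        (Function.minimalPeriod σ x : ℤ) ∣ b → a - b ≠ 0 → |a - b| < 6 → False :=
      fun a b ha hb => hd _ (dvd_sub ha hb)
    have h0 := hdvd 0 le_rfl (by norm_num)
    have h1 := hdvd 1 (by norm_num) (by norm_num)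
    have h2 := hdvd 2 (by norm_num) le_rfl
    rcases h0 with h0 | h0
    · rcases h2 with h2 | h2
      · exact hdd _ _ h0 h2 (by omega) (by rw [abs_lt]; omega)
      · exact hdd _ _ h0 h2 (by omega) (by rw [abs_lt]; omega)
    · rcases h1 with h1 | h1
      · exact hdd _ _ h0 h1 (by omega) (by rw [abs_lt]; omega)
      · exact hdd _ _ h0 h1 (by omega) (by rw [abs_lt]; omega)

theorem cliqueDivergent_of_rotation [Fintype V]
    (hadj : ∀ u v, G.Adj u v ↔ v = σ u ∨ u = σ v) (hcard : 9 ≤ Fintype.card V) :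
    Gᶜ.CliqueDivergent := by
  have : Nonempty V := Fintype.card_pos_iff.1 (by omega)
  obtain ⟨x⟩ := this
  have : Nonempty V := ⟨x⟩
  by_cases hone : ∀ y, σ.SameCycle x y
  · refine cliqueDivergent_of_minimalPeriod hadj x (hcard.trans ?_)
    have hs : Function.Surjective
        fun i : Fin (Function.minimalPeriod σ x) => (σ ^ (i : ℤ)) x :=
      fun y => exists_pow_eq_of_sameCycle (hone y)
    simpa using Fintype.card_le_of_surjective _ hs
  obtain ⟨y, hxy⟩ := not_forall.1 hone
  by_cases htwo : ∀ z, σ.SameCycle x z ∨ σ.SameCycle y z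
  · have hs : Function.Surjective (Sum.elim
        (fun i : Fin (Function.minimalPeriod σ x) => (σ ^ (i : ℤ)) x)
        fun i : Fin (Function.minimalPeriod σ y) => (σ ^ (i : ℤ)) y) := by
      intro z
      rcases htwo z with hz | hz
      · obtain ⟨i, hi⟩ := exists_pow_eq_of_sameCycle hz
        exact ⟨Sum.inl i, hi⟩
      · obtain ⟨i, hi⟩ := exists_pow_eq_of_sameCycle hz
        exact ⟨Sum.inr i, hi⟩
    have hle := Fintype.card_le_of_surjective _ hs
    rw [Fintype.card_sum, Fintype.card_fin, Fintype.card_fin] at hle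
    have hyx : ¬ σ.SameCycle y x := fun e => hxy e.symm
    -- The two lengths sum to at least 9, so if both are at most 5 they are 4 and 5, or 5 and 5.
    by_cases hx : 6 ≤ Function.minimalPeriod σ x
    · exact cliqueDivergent_of_six_le hadj hxy hx
    by_cases hy : 6 ≤ Function.minimalPeriod σ y
    · exact cliqueDivergent_of_six_le hadj hyx hy
    by_cases hx4 : Function.minimalPeriod σ x = 4
    · exact cliqueDivergent_of_four_five hadj hxy hx4 (by omega)
    by_cases hy4 : Function.minimalPeriod σ y = 4
    · exact cliqueDivergent_of_four_five hadj hyx hy4 (by omega)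
    · exact cliqueDivergent_of_five_five hadj hxy (by omega) (by omega)
  · obtain ⟨z, hz⟩ := not_forall.1 htwo
    obtain ⟨hxz, hyz⟩ := not_or.1 hz
    refine (isCoaffination_compl hadj).cliqueDivergent ⟨![x, y, z], fun i j hij p q => ?_⟩
    have h1 := compl_adjOrEq_of_not_sameCycle hadj hxy
    have h2 := compl_adjOrEq_of_not_sameCycle hadj hxz
    have h3 := compl_adjOrEq_of_not_sameCycle hadj hyz
    fin_cases i <;> fin_cases j <;>
      first
      | exact absurd rfl hij
      | exact h1 p q | exact h2 p q | exact h3 p q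
      | exact (h1 q p).symm | exact (h2 q p).symm | exact (h3 q p).symm

end SimpleGraph

theorem mainTheorem4 {V : Type*} [Fintype V] (G : SimpleGraph V) [G.LocallyFinite]
    (hreg : G.IsRegularOfDegree 2) (hcard : 9 ≤ Fintype.card V) :
    Gᶜ.CliqueDivergent := by
  obtain ⟨σ, hσ⟩ := hreg.exists_rotation
  exact SimpleGraph.cliqueDivergent_of_rotation hσ hcard
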